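/- Let $\mathbb F_q$ be the finite field with $q$ elements, let $q\equiv 1\pmod 3$, and let $n$ be an integer with $5\le n\le q$. Then there exists an MDS $(3n,10)_q$ symbol-pair code. Here the symbol-pair distance of $u,v\in\mathbb F_q^N$ is $d_{sp}(u,v)=|\{0\le i\le N-1 : (u_i,u_{i+1})\ne(v_i,v_{i+1})\}|$ (subscripts modulo $N$), and an MDS $(N,d)_q$ symbol-pair code, $2\le d\le N$, is a set $\mathcal D\subseteq\mathbb F_q^N$ with $|\mathcal D|=q^{N-d+2}$ in which the minimum of $d_{sp}(u,v)$ over distinct $u,v\in\mathcal D$ equals $d$. More precisely, $\mathbb F_q$ contains a primitive cube root of unity, and for every primitive cube root of unity $\omega\in\mathbb F_q$ there are distinct $\alpha_0,\dots,\alpha_{n-1}\in\mathbb F_q$ for which the following code $\mathcal D$ is an MDS $(3n,10)_q$ symbol-pair code. Let $$GRS_i=\Big\{c\in\mathbb F_q^n : \sum_{j=0}^{n-1}\alpha_j^t c_j=0 \text{ for } 0\le t<i\Big\},\qquad A=\begin{pmatrix}1&1&1\\1&\omega&\omega^2\\1&\omega^2&\omega\end{pmatrix}=(a_{mi}),$$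 and let $$\mathcal C=[GRS_2,GRS_2,GRS_4]\cdot A=\Big\{\Big(\sum_m a_{m1}c_m,\ \sum_m a_{m2}c_m,\ \sum_m a_{m3}c_m\Big) : c_1,c_2\in GRS_2,\ c_3\in GRS_4\Big\}\subseteq\mathbb F_q^{3n}.$$ For $c\in\mathcal C$ write $c_{i,j}$ for the coordinate of $c$ with index $in+j$ ($0\le i\le 2$, $0\le j\le n-1$). The code $\mathcal D$ consists of the words $$\big(c_{0,0},c_{1,1},c_{2,0},\ c_{0,1},c_{1,2},c_{2,1},\ \dots,\ c_{0,n-1},c_{1,0},c_{2,n-1}\big),\qquad c\in\mathcal C,$$ that is, the coordinates $3j,\,3j+1,\,3j+2$ are $c_{0,j},\,c_{1,j+1},\,c_{2,j}$, with $j+1$ read modulo $n$. Moreover $\mathcal C$ and $\mathcal D$ are both linear codes of length $3n$, dimension $3n-8$ and minimum Hamming distance $5$. -/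

import Mathlib

namespace SymbolPair

/-- The symbol-pair read vector `((u₀,u₁), (u₁,u₂), …, (u_{N-1},u₀))` of `u`
(`finRotate N` is the cyclic shift `i ↦ i + 1` modulo `N`). -/
def readVector {Ω : Type*} {N : ℕ} (u : Fin N → Ω) : Fin N → Ω × Ω :=
  fun i => (u i, u (finRotate N i))

/-- The symbol-pair distance: the Hamming distance of the symbol-pair read vectors. -/
def pairDist {Ω : Type*} [DecidableEq Ω] {N : ℕ} (u v : Fin N → Ω) : ℕ :=
  hammingDist (readVector u) (readVector v)

/-- `d` is the minimum Hamming distance between distinct words of `C`. -/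
def IsMinHammingDist {Ω : Type*} [DecidableEq Ω] {N : ℕ} (C : Set (Fin N → Ω)) (d : ℕ) : Prop :=
  IsLeast {e : ℕ | ∃ u ∈ C, ∃ v ∈ C, u ≠ v ∧ hammingDist u v = e} d

/-- `d` is the minimum symbol-pair distance between distinct words of `C`. -/
def IsMinPairDist {Ω : Type*} [DecidableEq Ω] {N : ℕ} (C : Set (Fin N → Ω)) (d : ℕ) : Prop :=
  IsLeast {e : ℕ | ∃ u ∈ C, ∃ v ∈ C, u ≠ v ∧ pairDist u v = e} d

/-- `C` is an MDS `(N, d)_q` symbol-pair code, where `q` is the size of the alphabet: `2 ≤ d ≤ N`,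
the minimum symbol-pair distance of `C` is `d`, and `C` attains the Singleton bound
`|C| ≤ q ^ (N - d + 2)`. -/
structure IsMDSPairCode {Ω : Type*} [DecidableEq Ω] {N : ℕ} (C : Set (Fin N → Ω)) (d : ℕ) :
    Prop where
  two_le : 2 ≤ d
  le_length : d ≤ N
  minDist : IsMinPairDist C d
  card_eq : Nat.card C = Nat.card Ω ^ (N - d + 2)

/-- `C` is an `[N, k, d]` linear code over `F`. -/
structure IsLinearCode {F : Type*} [Field F] [DecidableEq F] {N : ℕ}
    (C : Submodule F (Fin N → F)) (k d : ℕ) : Prop where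
  dim_eq : Module.finrank F C = k
  minDist : IsMinHammingDist (C : Set (Fin N → F)) d

/-- The `i × n` matrix with rows `(α₀ᵗ, …, α_{n-1}ᵗ)`, `0 ≤ t < i`. -/
def parityCheck {F : Type*} [Field F] {n : ℕ} (α : Fin n → F) (i : ℕ) : Matrix (Fin i) (Fin n) F :=
  Matrix.of fun t j => α j ^ (t : ℕ)

/-- The generalized Reed-Solomon code `GRS_i` with evaluation points `α` and parity-check matrix
`parityCheck α i`. -/
def grs {F : Type*} [Field F] {n : ℕ} (α : Fin n → F) (i : ℕ) : Submodule F (Fin n → F) :=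
  LinearMap.ker (parityCheck α i).mulVecLin

/-- The matrix-product code `[C₁, …, C_M] · A`. A word of length `N * n` consists of `N` blocks of
length `n`; `finProdFinEquiv (i, j)` is the coordinate `i * n + j`, that is entry `j` of block `i`,
and block `i` is `∑ m, a_{m i} c_m` with `c_m ∈ C_m`. -/
def matrixProduct {F : Type*} [Field F] {M N n : ℕ} (C : Fin M → Submodule F (Fin n → F))
    (A : Matrix (Fin M) (Fin N) F) : Submodule F (Fin (N * n) → F) where
  carrier := {w | ∃ c : Fin M → Fin n → F, (∀ m, c m ∈ C m) ∧
    ∀ i j, w (finProdFinEquiv (i, j)) = ∑ m, A m i * c m j}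
  zero_mem' := ⟨0, fun m => (C m).zero_mem, fun i j => by simp⟩
  add_mem' := by
    rintro v w ⟨c, hc, hv⟩ ⟨d, hd, hw⟩
    refine ⟨c + d, fun m => (C m).add_mem (hc m) (hd m), fun i j => ?_⟩
    simp [hv, hw, mul_add, Finset.sum_add_distrib]
  smul_mem' := by
    rintro a w ⟨c, hc, hw⟩
    refine ⟨a • c, fun m => (C m).smul_mem a (hc m), fun i j => ?_⟩
    simp only [Pi.smul_apply, smul_eq_mul, hw, Finset.mul_sum]
    exact Finset.sum_congr rfl fun m _ => by ring

/-- The matrix with rows `(1, 1, 1)`, `(1, ω, ω²)`, `(1, ω², ω)`. -/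
def matA {F : Type*} [Field F] (ω : F) : Matrix (Fin 3) (Fin 3) F :=
  !![1, 1, 1; 1, ω, ω ^ 2; 1, ω ^ 2, ω]

/-- The numbering `(j, i) ↦ i + 3 * j` of the coordinates `0, …, 3 * n - 1`. -/
def interleaved (n : ℕ) : Fin n × Fin 3 ≃ Fin (3 * n) :=
  finProdFinEquiv.trans (finCongr (Nat.mul_comm n 3))

/-- The permutation `ρ(i * n + j) = i + 3 * j`. -/
def rho (n : ℕ) : Equiv.Perm (Fin (3 * n)) :=
  (finProdFinEquiv.symm.trans (Equiv.prodComm (Fin 3) (Fin n))).trans (interleaved n)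

/-- The permutation `φ(i + 3 * j) = i + 3 * j` for `i = 0, 2` and
`φ(1 + 3 * j) = 1 + 3 * (j + 1)`, with `j + 1` read modulo `n`. -/
def phi (n : ℕ) : Equiv.Perm (Fin (3 * n)) :=
  ((interleaved n).symm.trans
    ((Equiv.prodComm (Fin n) (Fin 3)).trans
      ((Equiv.prodShear (Equiv.refl (Fin 3))
        (fun i => if i = 1 then finRotate n else Equiv.refl (Fin n))).trans
          (Equiv.prodComm (Fin 3) (Fin n))))).trans (interleaved n)

/-- The word obtained from `c` by moving the entry in position `l` to position `ρ(l)`, and then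
putting into each position `l` the entry that is in position `φ(l)`. With
`c_{i,j} = c_{i * n + j}` the result is
`c_{0,0}, c_{1,1}, c_{2,0}, c_{0,1}, c_{1,2}, c_{2,1}, …, c_{0,n-1}, c_{1,0}, c_{2,n-1}`. -/
def permuteWord (F : Type*) [Field F] (n : ℕ) : (Fin (3 * n) → F) →ₗ[F] (Fin (3 * n) → F) :=
  LinearMap.funLeft F F fun l => (rho n).symm (phi n l)

theorem permuteWord_apply {F : Type*} [Field F] {n : ℕ} (c : Fin (3 * n) → F) (i : Fin 3)
    (j : Fin n) :
    permuteWord F n c (interleaved n (j, i)) =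
      c (finProdFinEquiv (i, if i = 1 then finRotate n j else j)) := by
  by_cases h : i = 1 <;> simp [permuteWord, LinearMap.funLeft_apply, rho, phi, h]

/-- The matrix-product code `[GRS_2, GRS_2, GRS_4] · A`. -/
def codeC {F : Type*} [Field F] {n : ℕ} (ω : F) (α : Fin n → F) : Submodule F (Fin (3 * n) → F) :=
  matrixProduct ![grs α 2, grs α 2, grs α 4] (matA ω)

/-- The permuted code `φ(ρ([GRS_2, GRS_2, GRS_4] · A))`. -/
def codeD {F : Type*} [Field F] {n : ℕ} (ω : F) (α : Fin n → F) : Submodule F (Fin (3 * n) → F) :=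
  (codeC ω α).map (permuteWord F n)

end SymbolPair

namespace SymbolPair

/-! Every block of a word of `codeC` lies in `grs α 2`, so it is zero or has weight at least 3. The
combination of the blocks with coefficients 1, ω, ω² recovers three times the third component and
lies in `grs α 4`, so a block that is the only nonzero one has weight at least 5. After
interleaving, the pair weight is the sum of the sizes of the unions of cyclically adjacent row
supports (`hammingNorm_readVector_permuteWord`). A single nonzero block is counted twice and gives
at least 10. Two nonzero blocks with row supports S, T give |S| + |T| + |S ∪ T|, at least 10 unless
S = T has three elements. Three nonzero blocks give at least 9, with equality only if a 3-set is
invariant under the cyclic shift, impossible for n ≥ 5.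

The shift φ of the middle row handles the exceptional two-block case: there the supports of the two
blocks are a 3-set J and its rotation. The `grs α 4` condition then forces the evaluation points on
both sets to have the same sum (`sum_support_eq_of_smul_add_smul_mem_grs_four`), which says that
three of the cyclic differences of α add up to zero.

It remains to order n distinct field elements so that this never happens
(`hasTripleFreeCycle_field`). This is a question about the additive group 𝔽_p × V, where p ≠ 3
because q ≡ 1 mod 3. Steps with first coordinate 1 work unless n ≡ 3 mod p; that case needs a turn
at the end for p ≥ 5, and a walk on a cube for p = 2. -/

/-! ### Cyclic orderings in which no three differences cancel -/

/-- `G` contains `n` distinct elements `α₀, …, α_{n-1}` such that no three of the differences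
`α_{j+1} - α_j`, with `j` modulo `n`, add up to zero. -/
def HasTripleFreeCycle (G : Type*) [AddCommGroup G] (n : ℕ) : Prop :=
  ∃ α : Fin n → G, Function.Injective α ∧
    ∀ J : Finset (Fin n), J.card = 3 → ∑ j ∈ J, α (finRotate n j) ≠ ∑ j ∈ J, α j

theorem HasTripleFreeCycle.map {G H : Type*} [AddCommGroup G] [AddCommGroup H] {n : ℕ}
    (h : HasTripleFreeCycle G n) (e : G ≃+ H) : HasTripleFreeCycle H n := by
  obtain ⟨α, hα, hJ⟩ := h
  refine ⟨fun j => e (α j), e.injective.comp hα, fun J hc heq => hJ J hc (e.injective ?_)⟩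
  simpa only [map_sum] using heq

theorem finset_card_three_ordered {n : ℕ} {J : Finset (Fin n)} (hJ : J.card = 3) :
    ∃ i j k : Fin n, i < j ∧ j < k ∧ J = {i, j, k} := by
  let f := J.orderEmbOfFin hJ
  refine ⟨f 0, f 1, f 2, ?_, ?_, ?_⟩
  · exact f.strictMono (by decide)
  · exact f.strictMono (by decide)
  · have h := Finset.image_orderEmbOfFin_univ J hJ
    rw [← h, show (Finset.univ : Finset (Fin 3)) = {0, 1, 2} from rfl]
    simp [Finset.image_insert, f]

/-- Of three ordered indices only the largest can be the last one, so the wrap-around difference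
occurs at most once and two kinds of triples suffice. -/
theorem hasTripleFreeCycle_of_seq {G : Type*} [AddCommGroup G] {n : ℕ} (a : ℕ → G)
    (hinj : ∀ i j, i < n → j < n → a i = a j → i = j)
    (hopen : ∀ i j k, i < j → j < k → k + 1 < n →
      (a (i + 1) - a i) + (a (j + 1) - a j) + (a (k + 1) - a k) ≠ 0)
    (hclosed : ∀ i j, i < j → j + 1 < n →
      (a (i + 1) - a i) + (a (j + 1) - a j) + (a 0 - a (n - 1)) ≠ 0) :
    HasTripleFreeCycle G n := by
  refine ⟨fun j => a j, fun i j h => Fin.ext (hinj _ _ i.2 j.2 h), fun J hJ heq => ?_⟩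
  obtain ⟨i, j, k, hij, hjk, rfl⟩ := finset_card_three_ordered hJ
  obtain _ | n := n
  · exact i.elim0
  have hrot : ∀ x : Fin (n + 1), x < k → ((finRotate (n + 1) x : Fin (n + 1)) : ℕ) = x + 1 := by
    intro x hx
    rw [coe_finRotate, if_neg]
    rintro rfl
    exact absurd (Fin.le_last k) (not_le.mpr hx)
  have hik := hij.trans hjk
  rw [Finset.sum_insert (by simp [hij.ne, hik.ne]), Finset.sum_insert (by simp [hjk.ne]),
    Finset.sum_singleton, Finset.sum_insert (by simp [hij.ne, hik.ne]),
    Finset.sum_insert (by simp [hjk.ne]), Finset.sum_singleton] at heq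
  simp only [hrot i hik, hrot j hjk, coe_finRotate] at heq
  have hkn := k.2
  rw [Fin.lt_def] at hij hjk
  split_ifs at heq with hk
  · subst hk
    apply hclosed i j hij (by simp at hjk; omega)
    simp only [Fin.val_last, Nat.add_sub_cancel] at heq ⊢
    rw [← sub_eq_zero] at heq
    rw [← heq]
    abel
  · have hk' : (k : ℕ) ≠ n := fun h => hk (Fin.ext (by simpa using h))
    apply hopen i j k hij hjk (by omega)
    rw [← sub_eq_zero] at heq
    rw [← heq]
    abel

/-- An enumeration of a finite type, as a sequence. -/
theorem exists_seq_injOn_card (V : Type*) [Fintype V] [Nonempty V] :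
    ∃ v : ℕ → V, ∀ i j, i < Fintype.card V → j < Fintype.card V → v i = v j → i = j := by
  let e := Fintype.equivFin V
  have : NeZero (Fintype.card V) := ⟨Fintype.card_ne_zero⟩
  refine ⟨fun i => e.symm (Fin.ofNat _ i), fun i j hi hj h => ?_⟩
  have h' := congrArg Fin.val (e.symm.injective h)
  simpa [Fin.ofNat, Nat.mod_eq_of_lt hi, Nat.mod_eq_of_lt hj] using h'

/-! ### Odd characteristic, and n not congruent to 3 -/

section Staircase

variable {p : ℕ} {V : Type*}

/-- The sequence in `ZMod p × V` that runs through the fibres of the second projection. -/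
def staircase (p : ℕ) (v : ℕ → V) (j : ℕ) : ZMod p × V := ((j : ZMod p), v (j / p))

theorem staircase_injOn [Fintype V] {v : ℕ → V}
    (hv : ∀ i j, i < Fintype.card V → j < Fintype.card V → v i = v j → i = j) {i j : ℕ}
    (hi : i < p * Fintype.card V) (hj : j < p * Fintype.card V)
    (h : staircase p v i = staircase p v j) : i = j := by
  obtain ⟨h1, h2⟩ := Prod.ext_iff.mp h
  have h3 := hv _ _ (Nat.div_lt_of_lt_mul hi) (Nat.div_lt_of_lt_mul hj) h2
  have h4 : i % p = j % p := (ZMod.natCast_eq_natCast_iff i j p).mp h1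
  rw [← Nat.div_add_mod i p, ← Nat.div_add_mod j p, h3, h4]

theorem three_ne_zero_zmod (hp : p.Prime) (hp3 : p ≠ 3) : (3 : ZMod p) ≠ 0 := by
  intro h
  have h' : ((3 : ℕ) : ZMod p) = 0 := by exact_mod_cast h
  rw [ZMod.natCast_eq_zero_iff] at h'
  exact hp3 ((Nat.prime_dvd_prime_iff_eq hp Nat.prime_three).mp h')

/-- All steps have first coordinate 1 and the closing difference has 1 - n, so a triple sums to 3 or
to 3 - n there. -/
theorem hasTripleFreeCycle_staircase [AddCommGroup V] [Fintype V] (hp : p.Prime) (hp3 : p ≠ 3) {n : ℕ}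
    (hn : 1 ≤ n) (hn3 : (n : ZMod p) ≠ 3) (hnq : n ≤ p * Fintype.card V) :
    HasTripleFreeCycle (ZMod p × V) n := by
  obtain ⟨v, hv⟩ := exists_seq_injOn_card V
  refine hasTripleFreeCycle_of_seq (staircase p v)
    (fun i j hi hj h => staircase_injOn hv (by omega) (by omega) h) ?_ ?_
  · intro i j k _ _ _ h
    have h1 := congrArg Prod.fst h
    simp only [staircase, Prod.fst_add, Prod.fst_sub, Prod.fst_zero] at h1
    push_cast at h1
    exact three_ne_zero_zmod hp hp3 (by linear_combination h1)
  · intro i j _ _ h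
    have h1 := congrArg Prod.fst h
    simp only [staircase, Prod.fst_add, Prod.fst_sub, Prod.fst_zero] at h1
    rw [Nat.cast_sub hn] at h1
    push_cast at h1
    exact hn3 (by linear_combination -h1)

/-- Reversing direction at the end gives differences with first coordinates 1, …, 1, -1, -1, 2.
Triples then sum to 3, 1, -1, 4, 2 or 0, and 0 arises only from the last three differences, where
injectivity takes over. -/
theorem hasTripleFreeCycle_mul_add_three [AddCommGroup V] [Fintype V] (hp : p.Prime) (hp5 : 5 ≤ p) {m : ℕ}
    (hm : 1 ≤ m) (hnq : m * p + 3 ≤ p * Fintype.card V) :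
    HasTripleFreeCycle (ZMod p × V) (m * p + 3) := by
  have := Fact.mk hp
  obtain ⟨v, hv⟩ := exists_seq_injOn_card V
  have hmV : m < Fintype.card V := by
    by_contra! hle
    have := Nat.mul_le_mul_left p hle
    rw [mul_comm p m] at this
    omega
  have hp0 : ((m * p : ℕ) : ZMod p) = 0 := by simp
  have h2 : (2 : ZMod p) ≠ 0 := by
    intro h
    have h' : ((2 : ℕ) : ZMod p) = 0 := by exact_mod_cast h
    have := Nat.le_of_dvd (by norm_num) ((ZMod.natCast_eq_zero_iff 2 p).mp h')
    omega
  have h4 : (4 : ZMod p) ≠ 0 := by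
    intro h
    exact mul_ne_zero h2 h2 (by rw [← h]; norm_num)
  have h3 := three_ne_zero_zmod hp (by omega)
  -- the terms are those with indices `≤ m p`, followed by those with `m p + p - 1`, `m p + p - 2`
  let σ : ℕ → ℕ := fun j => if j ≤ m * p then j else 2 * (m * p) + p - j
  have hσlow : ∀ {j}, j ≤ m * p → σ j = j := fun h => if_pos h
  have hσ1 : σ (m * p + 1) = m * p + (p - 1) := by
    simp only [σ]; rw [if_neg (by omega)]; omega
  have hσ2 : σ (m * p + 2) = m * p + (p - 2) := by
    simp only [σ]; rw [if_neg (by omega)]; omega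
  have hσlt : ∀ j, j < m * p + 3 → σ j < p * Fintype.card V := by
    intro j hj
    have : m * p + p ≤ p * Fintype.card V := by
      have := Nat.mul_le_mul_left p hmV
      rw [Nat.mul_succ, mul_comm p m] at this
      exact this
    simp only [σ]
    split_ifs <;> omega
  have c1 : ((m * p + (p - 1) : ℕ) : ZMod p) = -1 := by
    rw [Nat.cast_add, hp0, Nat.cast_sub (by omega)]; simp
  have c2 : ((m * p + (p - 2) : ℕ) : ZMod p) = -2 := by
    rw [Nat.cast_add, hp0, Nat.cast_sub (by omega)]; simp
  let a : ℕ → ZMod p × V := fun j => staircase p v (σ j)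
  have fst_low : ∀ j, j < m * p → (a (j + 1) - a j).1 = 1 := by
    intro j hj
    simp only [a, hσlow hj.le, hσlow (Nat.succ_le_of_lt hj), staircase, Prod.fst_sub]
    push_cast
    ring
  have fst_hi1 : (a (m * p + 1) - a (m * p)).1 = -1 := by
    simp only [a, hσlow le_rfl, hσ1, staircase, Prod.fst_sub, c1, hp0, sub_zero]
  have fst_hi2 : (a (m * p + 1 + 1) - a (m * p + 1)).1 = -1 := by
    simp only [a, hσ2, hσ1, staircase, Prod.fst_sub, c1, c2]
    ring
  have fst_close : (a 0 - a (m * p + 3 - 1)).1 = 2 := by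
    simp only [a, show m * p + 3 - 1 = m * p + 2 from rfl, hσ2, hσlow (Nat.zero_le _), staircase,
      Prod.fst_sub, c2]
    simp
  have split : ∀ j, j + 1 < m * p + 3 → j < m * p ∨ j = m * p ∨ j = m * p + 1 := by
    intro j hj; omega
  refine hasTripleFreeCycle_of_seq a ?_ ?_ ?_
  · intro i j hi hj h
    have := staircase_injOn hv (hσlt i hi) (hσlt j hj) h
    simp only [σ] at this
    split_ifs at this <;> omega
  · intro i j k hij hjk hk h
    have h1 : _ = (0 : ZMod p) := congrArg Prod.fst h
    rw [Prod.fst_add, Prod.fst_add, fst_low i (by omega)] at h1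
    rcases split k hk with hk | rfl | rfl
    · rw [fst_low k hk, fst_low j (by omega)] at h1
      exact h3 (by linear_combination h1)
    · rw [fst_hi1, fst_low j (by omega)] at h1
      simp at h1
    · rcases split j (by omega) with hj | rfl | rfl
      · rw [fst_hi2, fst_low j hj] at h1
        simp at h1
      · rw [fst_hi2, fst_hi1] at h1
        simp at h1
      · omega
  · intro i j hij hj h
    have h1 : _ = (0 : ZMod p) := congrArg Prod.fst h
    rw [Prod.fst_add, Prod.fst_add, fst_close] at h1
    rcases split j hj with hj | rfl | rfl
    · rw [fst_low j hj, fst_low i (by omega)] at h1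
      exact h4 (by linear_combination h1)
    · rw [fst_hi1, fst_low i (by omega)] at h1
      exact h2 (by linear_combination h1)
    · rcases split i (by omega) with hi | rfl | rfl
      · rw [fst_hi2, fst_low i hi] at h1
        exact h2 (by linear_combination h1)
      -- Here the first coordinates do cancel; the sum telescopes to `a 0 - a (m * p)`, a difference
      -- of distinct terms.
      · have h5 : a 0 = a (m * p) := by
          rw [← sub_eq_zero, ← h]
          simp only [show m * p + 3 - 1 = m * p + 1 + 1 from rfl]
          abel
        have h6 := staircase_injOn hv (hσlt _ (by omega)) (hσlt _ (by omega)) h5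
        rw [hσlow (Nat.zero_le _), hσlow le_rfl] at h6
        have := Nat.mul_pos hm hp.pos
        omega
      · omega

end Staircase

/-! ### Characteristic two, odd n: walks on a cube -/

section CharTwo

/-- The steps of walks in `F₂⁴`: no three of them have sum zero, and no two of them have sum
`(0, 1, 1, 1)`. -/
def cubeSteps : Finset (Fin 4 → ZMod 2) :=
  {![1, 0, 0, 0], ![1, 1, 0, 0], ![1, 0, 1, 0], ![1, 0, 0, 1]}

/-- The vector of the binary digits of a natural number. -/
def bits (x : ℕ) : Fin 4 → ZMod 2 := fun i => ((x / 2 ^ (i : ℕ) : ℕ) : ZMod 2)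

theorem bits_injOn : ∀ x < 16, ∀ y < 16, bits x = bits y → x = y := by
  decide +kernel

theorem cubeSteps_add_three : ∀ s ∈ cubeSteps, ∀ t ∈ cubeSteps, ∀ u ∈ cubeSteps,
    s + t + u ≠ 0 := by
  decide +kernel

/-- Two steps together change at most two of the last three coordinates. -/
theorem cubeSteps_add_closing : ∀ s ∈ cubeSteps, ∀ t ∈ cubeSteps, s + t + ![0, 1, 1, 1] ≠ 0 := by
  decide +kernel

theorem hasTripleFreeCycle_of_cubeWalk {V : Type*} [AddCommGroup V] {n : ℕ} (x : ℕ → ℕ) (y : ℕ → V)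
    (hinj : ∀ i j, i < n → j < n → bits (x i) = bits (x j) → y i = y j → i = j)
    (hstep : ∀ i, i + 1 < n → bits (x (i + 1)) - bits (x i) ∈ cubeSteps)
    (hclose : bits (x 0) - bits (x (n - 1)) = ![0, 1, 1, 1]) :
    HasTripleFreeCycle ((Fin 4 → ZMod 2) × V) n := by
  refine hasTripleFreeCycle_of_seq (fun j => (bits (x j), y j)) ?_ ?_ ?_
  · intro i j hi hj h
    exact hinj i j hi hj (congrArg Prod.fst h) (congrArg Prod.snd h)
  · intro i j k hij hjk hk h
    exact cubeSteps_add_three _ (hstep i (by omega)) _ (hstep j (by omega)) _ (hstep k hk)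
      (congrArg Prod.fst h)
  · intro i j hij hj h
    refine cubeSteps_add_closing _ (hstep i (by omega)) _ (hstep j hj) ?_
    rw [← hclose]
    exact congrArg Prod.fst h

theorem hasTripleFreeCycle_of_list {V : Type*} [AddCommGroup V] (l : List ℕ)
    (hinj : ∀ i < l.length, ∀ j < l.length, bits (l.getD i 0) = bits (l.getD j 0) → i = j)
    (hstep : ∀ i < l.length - 1, bits (l.getD (i + 1) 0) - bits (l.getD i 0) ∈ cubeSteps)
    (hclose : bits (l.getD 0 0) - bits (l.getD (l.length - 1) 0) = ![0, 1, 1, 1]) :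
    HasTripleFreeCycle ((Fin 4 → ZMod 2) × V) l.length :=
  hasTripleFreeCycle_of_cubeWalk (fun i => l.getD i 0) (fun _ => 0)
    (fun i j hi hj h _ => hinj i hi j hj h) (fun i hi => hstep i (by omega)) hclose

/-- A Hamiltonian path of the three-dimensional cube between opposite vertices. -/
def cubePath (c : ℕ) : ℕ := [0, 1, 3, 2, 6, 4, 5, 7].getD c 0

theorem cubePath_lt : ∀ c < 8, cubePath c < 8 := by decide

theorem cubePath_injOn : ∀ c < 8, ∀ d < 8, cubePath c = cubePath d → c = d := by decide

theorem cubePath_step_even : ∀ c < 8,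
    bits (2 * cubePath c + 1) - bits (2 * cubePath c) ∈ cubeSteps := by
  decide +kernel

theorem cubePath_step_odd : ∀ c < 8, ∀ d < 8, d = c ∨ d = c + 1 →
    bits (2 * cubePath d) - bits (2 * cubePath c + 1) ∈ cubeSteps := by
  decide +kernel

/-- The lowest bit alternates while the other three follow a Hamiltonian path of the cube, slowed
down so that its 8 vertices are spread over the m + 1 even times. Since the path joins opposite
vertices, the closing difference is (0, 1, 1, 1). The `V`-coordinate separates visits to the same
vertex. -/
theorem hasTripleFreeCycle_odd_of_large {V : Type*} [AddCommGroup V] [Fintype V] {m : ℕ}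
    (hm : 7 ≤ m) (hmV : 2 * m + 1 ≤ 16 * Fintype.card V) :
    HasTripleFreeCycle ((Fin 4 → ZMod 2) × V) (2 * m + 1) := by
  obtain ⟨v, hv⟩ := exists_seq_injOn_card V
  set r := Fintype.card V with hr
  have hr0 : 0 < r := Fintype.card_pos
  let b : ℕ → ℕ := fun i => 8 * i / (m + 1)
  have hb8 : ∀ i ≤ m, b i < 8 := fun i hi => Nat.div_lt_of_lt_mul (by omega)
  -- The bound 7 ≤ m is what makes the slowed path reach its last vertex.
  have hbm : b m = 7 := Nat.div_eq_of_lt_le (by omega) (by omega)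
  have hb0 : b 0 = 0 := by simp [b]
  have hbs : ∀ i, b (i + 1) = b i ∨ b (i + 1) = b i + 1 := by
    intro i
    have h1 : b i ≤ b (i + 1) := Nat.div_le_div_right (by omega)
    have h2 : b (i + 1) ≤ b i + 1 := by
      have : b i + 1 = (8 * i + (m + 1)) / (m + 1) := (Nat.add_div_right _ (by omega)).symm
      rw [this]
      exact Nat.div_le_div_right (by omega)
    omega
  -- Equal values of `b` force 8(j - i) < m + 1 ≤ 8r, so i and j differ by less than r and are
  -- determined by their residues.
  have hbinj : ∀ i j, i ≤ j → b i = b j → i % r = j % r → i = j := by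
    intro i j hij h hmod
    have h1 := Nat.lt_mul_div_succ (8 * j) (show 0 < m + 1 by omega)
    have h2 := Nat.mul_div_le (8 * i) (m + 1)
    change _ < _ * (b j + 1) at h1
    change _ * b i ≤ _ at h2
    rw [← h, Nat.mul_succ] at h1
    obtain ⟨k, hk⟩ := (Nat.modEq_iff_dvd' hij).mp hmod
    obtain _ | k := k
    · omega
    · have : r ≤ r * (k + 1) := Nat.le_mul_of_pos_right r (by omega)
      omega
  have hx : ∀ j, j < 2 * m + 1 → 2 * cubePath (b (j / 2)) + j % 2 < 16 := by
    intro j hj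
    have := cubePath_lt _ (hb8 (j / 2) (by omega))
    omega
  refine hasTripleFreeCycle_of_cubeWalk (fun j => 2 * cubePath (b (j / 2)) + j % 2)
    (fun j => v (j / 2 % r)) ?_ ?_ ?_
  · intro i j hi hj h1 h2
    have h3 := bits_injOn _ (hx i hi) _ (hx j hj) h1
    have h4 : b (i / 2) = b (j / 2) :=
      cubePath_injOn _ (hb8 _ (by omega)) _ (hb8 _ (by omega)) (by omega)
    have h5 := hv _ _ (Nat.mod_lt _ hr0) (Nat.mod_lt _ hr0) h2
    have h6 : i / 2 = j / 2 := by
      rcases le_total (i / 2) (j / 2) with h | h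
      · exact hbinj _ _ h h4 h5
      · exact (hbinj _ _ h h4.symm h5.symm).symm
    omega
  · intro i hi
    rcases Nat.mod_two_eq_zero_or_one i with h | h
    · simp only [h, show (i + 1) % 2 = 1 by omega, show (i + 1) / 2 = i / 2 by omega, add_zero]
      exact cubePath_step_even _ (hb8 _ (by omega))
    · simp only [h, show (i + 1) % 2 = 0 by omega, show (i + 1) / 2 = i / 2 + 1 by omega, add_zero]
      exact cubePath_step_odd _ (hb8 _ (by omega)) _ (hb8 _ (by omega)) (hbs _)
  · simp only [show (2 * m + 1 - 1) / 2 = m by omega, show (2 * m + 1 - 1) % 2 = 0 by omega, hbm,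
      Nat.zero_div, hb0, Nat.zero_mod]
    decide +kernel

theorem hasTripleFreeCycle_odd {V : Type*} [AddCommGroup V] [Fintype V] {m : ℕ}
    (hm : 2 ≤ m) (hmV : 2 * m + 1 ≤ 16 * Fintype.card V) :
    HasTripleFreeCycle ((Fin 4 → ZMod 2) × V) (2 * m + 1) := by
  rcases Nat.lt_or_ge m 7 with h | h
  · interval_cases m
    · exact hasTripleFreeCycle_of_list [0, 1, 2, 7, 14] (by decide +kernel) (by decide +kernel)
        (by decide +kernel)
    · exact hasTripleFreeCycle_of_list [0, 1, 2, 3, 6, 7, 14] (by decide +kernel)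
        (by decide +kernel) (by decide +kernel)
    · exact hasTripleFreeCycle_of_list [0, 1, 2, 3, 6, 7, 4, 13, 14] (by decide +kernel)
        (by decide +kernel) (by decide +kernel)
    · exact hasTripleFreeCycle_of_list [0, 1, 2, 3, 6, 7, 4, 5, 12, 13, 14] (by decide +kernel)
        (by decide +kernel) (by decide +kernel)
    · exact hasTripleFreeCycle_of_list [0, 1, 2, 3, 6, 7, 4, 5, 12, 13, 8, 11, 14]
        (by decide +kernel) (by decide +kernel) (by decide +kernel)
  · exact hasTripleFreeCycle_odd_of_large h hmV

end CharTwo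

/-! ### Transfer to the additive group of the field -/

theorem nonempty_addEquiv_prod (K F W : Type*) [Field K] [Fintype K] [AddCommGroup F] [Module K F]
    [Module.Finite K F] [AddCommGroup W] [Module K W] [Module.Finite K W]
    (h : Module.finrank K W ≤ Module.finrank K F) :
    ∃ k, Nonempty (W × (Fin k → K) ≃+ F) :=
  ⟨Module.finrank K F - Module.finrank K W,
    ⟨(LinearEquiv.ofFinrankEq (R := K) _ _ (by simp; omega)).toAddEquiv⟩⟩

theorem hasTripleFreeCycle_field {F : Type*} [Field F] [Fintype F] {n : ℕ}
    (hq : Fintype.card F ≡ 1 [MOD 3]) (hn5 : 5 ≤ n) (hnq : n ≤ Fintype.card F) :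
    HasTripleFreeCycle F n := by
  obtain ⟨p, hchar⟩ := CharP.exists F
  have hp : p.Prime := CharP.char_is_prime F p
  have := Fact.mk hp
  let _ : Algebra (ZMod p) F := ZMod.algebra F p
  have hcard : Fintype.card F = p ^ Module.finrank (ZMod p) F := by
    simpa [ZMod.card] using Module.card_eq_pow_finrank (K := ZMod p) (V := F)
  have hfin : 1 ≤ Module.finrank (ZMod p) F := Module.finrank_pos
  have hp3 : p ≠ 3 := by
    rintro rfl
    have h3 : 3 ∣ Fintype.card F := hcard ▸ dvd_pow_self 3 (by omega)
    rw [Nat.ModEq] at hq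
    omega
  obtain ⟨k, ⟨e⟩⟩ := nonempty_addEquiv_prod (ZMod p) F (ZMod p) (by simpa using hfin)
  have hk : p * Fintype.card (Fin k → ZMod p) = Fintype.card F := by
    rw [← Fintype.card_congr e.toEquiv, Fintype.card_prod, ZMod.card]
  by_cases hn3 : (n : ZMod p) = 3
  · rcases eq_or_ne p 2 with rfl | hp2
    · have hodd : n % 2 = 1 := by
        have : ((n : ℕ) : ZMod 2) = (3 : ℕ) := by exact_mod_cast hn3
        exact (ZMod.natCast_eq_natCast_iff n 3 2).mp this
      -- The orders 2 and 8 are not 1 mod 3, and the orders 1 and 4 are below 5 ≤ n.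
      have h4 : 4 ≤ Module.finrank (ZMod 2) F := by
        by_contra! hlt
        rw [Nat.ModEq] at hq
        generalize Module.finrank (ZMod 2) F = d at hlt hcard
        interval_cases d <;> omega
      obtain ⟨k', ⟨e'⟩⟩ := nonempty_addEquiv_prod (ZMod 2) F (Fin 4 → ZMod 2) (by simpa using h4)
      have hk' : 16 * Fintype.card (Fin k' → ZMod 2) = Fintype.card F := by
        rw [← Fintype.card_congr e'.toEquiv, Fintype.card_prod]
        simp
      have := hasTripleFreeCycle_odd (V := Fin k' → ZMod 2) (m := n / 2) (by omega) (by omega)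
      rw [show 2 * (n / 2) + 1 = n by omega] at this
      exact this.map e'
    · have hp5 : 5 ≤ p := by
        by_contra! hlt
        have := hp.two_le
        interval_cases p
        · exact hp2 rfl
        · exact hp3 rfl
        · exact absurd hp (by norm_num)
      have hdvd : p ∣ n - 3 := by
        rw [← ZMod.natCast_eq_zero_iff, Nat.cast_sub (by omega), hn3]
        simp
      obtain ⟨m, hm⟩ := hdvd
      have hm1 : 1 ≤ m := by
        rcases Nat.eq_zero_or_pos m with rfl | h
        · omega
        · exact h
      have hn : m * p + 3 = n := by rw [mul_comm]; omega
      have := hasTripleFreeCycle_mul_add_three (V := Fin k → ZMod p) hp hp5 hm1 (by omega)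
      rw [hn] at this
      exact this.map e
  · exact (hasTripleFreeCycle_staircase hp hp3 (by omega) hn3 (by omega)).map e

/-! ### Generalized Reed-Solomon codes -/

section Grs

variable {F : Type*} [Field F] {n : ℕ} {α : Fin n → F}

theorem mem_grs {i : ℕ} {c : Fin n → F} :
    c ∈ grs α i ↔ ∀ t < i, ∑ j, α j ^ t * c j = 0 := by
  simp only [grs, LinearMap.mem_ker, Matrix.mulVecLin_apply, funext_iff, Matrix.mulVec, dotProduct,
    parityCheck, Matrix.of_apply, Pi.zero_apply]
  exact ⟨fun h t ht => h ⟨t, ht⟩, fun h t => h t t.2⟩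

theorem grs_anti {i k : ℕ} (h : i ≤ k) : grs α k ≤ grs α i :=
  fun _ hc => mem_grs.mpr fun t ht => mem_grs.mp hc t (ht.trans_le h)

theorem sum_eval_mul_eq_zero {i : ℕ} {c : Fin n → F} (hc : c ∈ grs α i) {f : Polynomial F}
    (hf : f.natDegree < i) : ∑ j, f.eval (α j) * c j = 0 := by
  simp only [Polynomial.eval_eq_sum_range' hf, Finset.sum_mul]
  rw [Finset.sum_comm]
  refine Finset.sum_eq_zero fun t ht => ?_
  simp only [mul_assoc, ← Finset.mul_sum]
  rw [mem_grs.mp hc t (Finset.mem_range.mp ht), mul_zero]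

/-- If the weight were at most i, the polynomial vanishing at all support points but one would have
degree below i; pairing it with c isolates a single nonzero term. -/
theorem lt_hammingNorm_of_mem_grs [DecidableEq F] (hα : Function.Injective α) {i : ℕ}
    {c : Fin n → F} (hc : c ∈ grs α i) (h0 : c ≠ 0) : i < hammingNorm c := by
  by_contra! hle
  obtain ⟨j₀, hj₀⟩ := Function.ne_iff.mp h0
  rw [Pi.zero_apply] at hj₀
  have hmem : j₀ ∈ Finset.univ.filter (fun j => c j ≠ 0) := by simpa using hj₀
  let f : Polynomial F := ∏ j ∈ (Finset.univ.filter (fun j => c j ≠ 0)).erase j₀,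
    (Polynomial.X - Polynomial.C (α j))
  have hdeg : f.natDegree < i := by
    rw [Polynomial.natDegree_prod_of_monic _ _ fun j _ => Polynomial.monic_X_sub_C _]
    simp only [Polynomial.natDegree_X_sub_C, Finset.sum_const, smul_eq_mul, mul_one]
    rw [Finset.card_erase_of_mem hmem]
    have := Finset.card_pos.mpr ⟨j₀, hmem⟩
    simp only [hammingNorm] at hle
    omega
  have hsum := sum_eval_mul_eq_zero hc hdeg
  rw [Finset.sum_eq_single j₀] at hsum
  · refine (mul_ne_zero ?_ hj₀) hsum
    rw [Polynomial.eval_prod, Finset.prod_ne_zero_iff]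
    intro j hj
    simp only [Polynomial.eval_sub, Polynomial.eval_X, Polynomial.eval_C]
    exact sub_ne_zero.mpr fun h => (Finset.ne_of_mem_erase hj) (hα h).symm
  · intro j _ hj
    by_cases hcj : c j = 0
    · rw [hcj, mul_zero]
    · rw [Polynomial.eval_prod, Finset.prod_eq_zero (i := j), zero_mul]
      · simp [hj, hcj]
      · simp
  · simp

theorem finrank_grs (hα : Function.Injective α) {i : ℕ} (hi : i ≤ n) :
    Module.finrank F (grs α i) = n - i := by
  have hind : LinearIndependent F (parityCheck α i).row := by
    rw [Fintype.linearIndependent_iff]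
    intro g hg t
    have := Matrix.eq_zero_of_forall_index_sum_mul_pow_eq_zero
      (f := fun j : Fin i => α (Fin.castLE hi j)) (v := g)
      (hα.comp (Fin.castLE_injective hi)) fun j => by
        have h := congrFun hg (Fin.castLE hi j)
        simpa [parityCheck, Matrix.row] using h
    exact congrFun this t
  have hrank := hind.rank_matrix
  have h := LinearMap.finrank_range_add_finrank_ker (parityCheck α i).mulVecLin
  rw [Matrix.rank] at hrank
  rw [hrank] at h
  simp only [Fintype.card_fin, Module.finrank_fintype_fun_eq_card] at h
  change i + Module.finrank F (grs α i) = n at h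
  omega

/-- Restricted to i + 1 coordinates, the i parity checks have a nonzero solution, and the minimum
distance makes all its entries nonzero. -/
theorem exists_mem_grs_hammingNorm [DecidableEq F] (hα : Function.Injective α) {i : ℕ}
    (hi : i < n) : ∃ c ∈ grs α i, hammingNorm c = i + 1 := by
  have hker := LinearMap.ker_ne_bot_of_finrank_lt
    (f := (parityCheck (fun j : Fin (i + 1) => α (Fin.castLE hi j)) i).mulVecLin) (by simp)
  obtain ⟨b, hb, hb0⟩ := Submodule.exists_mem_ne_zero_of_ne_bot hker
  have hinj : Function.Injective (Fin.castLE hi) := Fin.castLE_injective hi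
  have hb' : b ∈ grs (fun j : Fin (i + 1) => α (Fin.castLE hi j)) i := hb
  let c : Fin n → F := Function.extend (Fin.castLE hi) b 0
  have hcb : ∀ j, c (Fin.castLE hi j) = b j := fun j => hinj.extend_apply b (0 : Fin n → F) j
  have hc0 : ∀ j, j ∉ Set.range (Fin.castLE hi) → c j = 0 := fun j hj =>
    Function.extend_apply' b (0 : Fin n → F) j hj
  have hc : c ∈ grs α i := by
    rw [mem_grs]
    intro t ht
    rw [← mem_grs.mp hb' t ht]
    refine (Fintype.sum_of_injective (Fin.castLE hi) hinj _ _ (fun j hj => ?_) fun j => ?_).symm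
    · rw [hc0 j hj, mul_zero]
    · rw [hcb]
  have hcne : c ≠ 0 := fun h => hb0 (funext fun j => by rw [← hcb, h]; rfl)
  refine ⟨c, hc, le_antisymm ?_ (lt_hammingNorm_of_mem_grs hα hc hcne)⟩
  calc hammingNorm c ≤ (Finset.univ.image (Fin.castLE hi)).card := by
        refine Finset.card_le_card fun j hj => ?_
        by_contra hj'
        exact (Finset.mem_filter.mp hj).2 (hc0 j fun ⟨x, hx⟩ =>
          hj' (Finset.mem_image.mpr ⟨x, Finset.mem_univ x, hx⟩))
    _ ≤ i + 1 := Finset.card_image_le.trans (by simp)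

/-- On the support, α is a root of the monic cubic with roots at the three points of J. Its lower
two coefficients meet vanishing moments, leaving only the first elementary symmetric function. -/
theorem sum_cube_mul_of_support_card_three {c : Fin n → F} (hc : c ∈ grs α 2) {J : Finset (Fin n)}
    (hJ : J.card = 3) (hcJ : ∀ j, j ∉ J → c j = 0) :
    ∑ j, α j ^ 3 * c j = (∑ j ∈ J, α j) * ∑ j, α j ^ 2 * c j := by
  obtain ⟨x, y, z, hxy, hxz, hyz, rfl⟩ := Finset.card_eq_three.mp hJ
  have h0 := mem_grs.mp hc 0 (by norm_num)
  have h1 := mem_grs.mp hc 1 (by norm_num)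
  have key : ∀ j, α j ^ 3 * c j = (α x + α y + α z) * (α j ^ 2 * c j)
      - (α x * α y + α x * α z + α y * α z) * (α j ^ 1 * c j)
      + (α x * α y * α z) * (α j ^ 0 * c j) := by
    intro j
    by_cases hj : j ∈ ({x, y, z} : Finset (Fin n))
    · simp only [Finset.mem_insert, Finset.mem_singleton] at hj
      rcases hj with rfl | rfl | rfl <;> ring
    · rw [hcJ j hj]; ring
  rw [Finset.sum_congr rfl fun j _ => key j, Finset.sum_add_distrib, Finset.sum_sub_distrib,
    ← Finset.mul_sum, ← Finset.mul_sum, ← Finset.mul_sum, h0, h1,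
    Finset.sum_insert (by simp [hxy, hxz]), Finset.sum_insert (by simp [hyz]),
    Finset.sum_singleton]
  ring

/-- The second and third moments of the combination vanish, and each third moment is its second
moment times the support sum. The second moment of a is nonzero, since otherwise a would be a word
of weight 3 in `grs α 3`; it can therefore be cancelled. -/
theorem sum_support_eq_of_smul_add_smul_mem_grs_four [DecidableEq F] (hα : Function.Injective α)
    {a b : Fin n → F} (ha : a ∈ grs α 2) (hb : b ∈ grs α 2) {x y : F} (hx : x ≠ 0)
    (hab : x • a + y • b ∈ grs α 4) {J K : Finset (Fin n)} (hJ : J.card = 3) (hK : K.card = 3)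
    (haJ : ∀ j, a j ≠ 0 ↔ j ∈ J) (hbK : ∀ j, b j ≠ 0 ↔ j ∈ K) :
    ∑ j ∈ J, α j = ∑ j ∈ K, α j := by
  have hsum : ∀ t < 4, x * ∑ j, α j ^ t * a j + y * ∑ j, α j ^ t * b j = 0 := by
    intro t ht
    rw [← mem_grs.mp hab t ht, Finset.mul_sum, Finset.mul_sum, ← Finset.sum_add_distrib]
    refine Finset.sum_congr rfl fun j _ => ?_
    simp only [Pi.add_apply, Pi.smul_apply, smul_eq_mul]
    ring
  have hne : ∑ j, α j ^ 2 * a j ≠ 0 := by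
    intro h
    have ha3 : a ∈ grs α 3 := by
      rw [mem_grs]
      intro t ht
      rcases Nat.lt_succ_iff_lt_or_eq.mp ht with h' | rfl
      · exact mem_grs.mp ha t h'
      · exact h
    have hw : hammingNorm a = 3 := by
      rw [← hJ]
      exact congrArg Finset.card (Finset.ext fun j => by simp [haJ])
    have ha0 : a ≠ 0 := fun h => by simp [h] at hw
    have := lt_hammingNorm_of_mem_grs hα ha3 ha0
    omega
  have h2 := hsum 2 (by norm_num)
  have h3 := hsum 3 (by norm_num)
  rw [sum_cube_mul_of_support_card_three ha hJ fun j hj => by simpa using mt (haJ j).mp hj,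
    sum_cube_mul_of_support_card_three hb hK fun j hj => by simpa using mt (hbK j).mp hj] at h3
  refine mul_left_cancel₀ (mul_ne_zero hx hne) ?_
  linear_combination h3 - (∑ j ∈ K, α j) * h2

end Grs

/-! ### Matrix-product codes and the matrix A -/

section MatrixProduct

variable {F : Type*} [Field F]

theorem finrank_matrixProduct {M n : ℕ} (C : Fin M → Submodule F (Fin n → F))
    {A : Matrix (Fin M) (Fin M) F} (hA : A.det ≠ 0) :
    Module.finrank F (matrixProduct C A) = ∑ m, Module.finrank F (C m) := by
  let Φ : (∀ m, C m) →ₗ[F] (Fin (M * n) → F) :=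
    { toFun := fun c k => ∑ m, A m (finProdFinEquiv.symm k).1 *
        (c m : Fin n → F) (finProdFinEquiv.symm k).2
      map_add' := fun c d => by
        ext k
        simp [mul_add, Finset.sum_add_distrib]
      map_smul' := fun x c => by
        ext k
        simp only [Pi.smul_apply, SetLike.val_smul, smul_eq_mul, RingHom.id_apply, Finset.mul_sum]
        exact Finset.sum_congr rfl fun m _ => by ring }
  have hΦ : Function.Injective Φ := by
    rw [← LinearMap.ker_eq_bot, LinearMap.ker_eq_bot']
    intro c hc
    ext m j
    have hv : (fun m => (c m : Fin n → F) j) = 0 := by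
      refine Matrix.eq_zero_of_vecMul_eq_zero hA (funext fun i => ?_)
      have := congrFun hc (finProdFinEquiv (i, j))
      simp only [Φ, LinearMap.coe_mk, AddHom.coe_mk, Equiv.symm_apply_apply, Pi.zero_apply] at this
      simp only [Matrix.vecMul, dotProduct, Pi.zero_apply]
      rw [← this]
      exact Finset.sum_congr rfl fun m _ => mul_comm _ _
    exact congrFun hv m
  have hrange : LinearMap.range Φ = matrixProduct C A := by
    ext w
    constructor
    · rintro ⟨c, rfl⟩
      refine ⟨fun m => c m, fun m => (c m).2, fun i j => ?_⟩
      simp only [Φ, LinearMap.coe_mk, AddHom.coe_mk, Equiv.symm_apply_apply]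
    · rintro ⟨c, hc, hw⟩
      refine ⟨fun m => ⟨c m, hc m⟩, funext fun k => ?_⟩
      obtain ⟨⟨i, j⟩, rfl⟩ := finProdFinEquiv.surjective k
      simp only [Φ, LinearMap.coe_mk, AddHom.coe_mk, Equiv.symm_apply_apply, hw]
  rw [← hrange, LinearMap.finrank_range_of_inj hΦ, Module.finrank_pi_fintype]

variable {ω : F}

theorem one_add_add_sq_eq_zero (hω : IsPrimitiveRoot ω 3) : 1 + ω + ω ^ 2 = 0 := by
  simpa [Finset.sum_range_succ] using hω.geom_sum_eq_zero (by norm_num)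

theorem three_ne_zero_of_primitiveRoot (hω : IsPrimitiveRoot ω 3) : (3 : F) ≠ 0 := by
  have h := one_add_add_sq_eq_zero hω
  have h1 : ω - 1 ≠ 0 := sub_ne_zero.mpr (hω.ne_one (by norm_num))
  have h2 : ω ^ 2 - 1 ≠ 0 :=
    sub_ne_zero.mpr (hω.pow_ne_one_of_pos_of_lt (by norm_num) (by norm_num))
  intro h3
  apply mul_ne_zero h1 h2
  -- (ω - 1)(ω² - 1) = 3.
  linear_combination h3 + (ω - 2) * h

theorem det_matA_ne_zero (hω : IsPrimitiveRoot ω 3) : (matA ω).det ≠ 0 := by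
  have h0 : ω ≠ 0 := hω.ne_zero (by norm_num)
  have h1 : ω - 1 ≠ 0 := sub_ne_zero.mpr (hω.ne_one (by norm_num))
  have h3 := three_ne_zero_of_primitiveRoot hω
  have h := one_add_add_sq_eq_zero hω
  have hdet : (matA ω).det = 3 * ω * (ω - 1) := by
    rw [Matrix.det_fin_three]
    simp only [matA, Matrix.of_apply, Matrix.cons_val', Matrix.cons_val_zero, Matrix.cons_val_one,
      Matrix.cons_val, Matrix.cons_val_fin_one]
    linear_combination (ω - ω ^ 2) * h
  rw [hdet]
  exact mul_ne_zero (mul_ne_zero h3 h0) h1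

variable {n : ℕ} {α : Fin n → F}

/-- The `i`-th of the three blocks of length `n` of a word of length `3 * n`. -/
def block (w : Fin (3 * n) → F) (i : Fin 3) : Fin n → F := fun j => w (finProdFinEquiv (i, j))

theorem block_mem_grs {w : Fin (3 * n) → F} (hw : w ∈ codeC ω α) (i : Fin 3) :
    block w i ∈ grs α 2 := by
  obtain ⟨c, hc, hwc⟩ := hw
  have hc2 : ∀ m, c m ∈ grs α 2 := by
    intro m
    have := hc m
    fin_cases m
    · exact this
    · exact this
    · exact grs_anti (by norm_num) this
  have : block w i = ∑ m, matA ω m i • c m := by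
    ext j
    simp [block, hwc]
  rw [this]
  exact Submodule.sum_mem _ fun m _ => Submodule.smul_mem _ _ (hc2 m)

/-- A maps the column (1, ω, ω²) to (0, 0, 3), so the first two components drop out. -/
theorem sum_block_mem_grs (hω : IsPrimitiveRoot ω 3) {w : Fin (3 * n) → F}
    (hw : w ∈ codeC ω α) :
    block w 0 + ω • block w 1 + ω ^ 2 • block w 2 ∈ grs α 4 := by
  obtain ⟨c, hc, hwc⟩ := hw
  have h := one_add_add_sq_eq_zero hω
  have : block w 0 + ω • block w 1 + ω ^ 2 • block w 2 = (3 : F) • c 2 := by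
    ext j
    simp only [Pi.add_apply, Pi.smul_apply, block, hwc, Fin.sum_univ_three, matA, Matrix.of_apply,
      Matrix.cons_val', Matrix.cons_val_zero, Matrix.cons_val_one, Matrix.cons_val,
      Matrix.cons_val_fin_one, smul_eq_mul]
    linear_combination (c 0 j + (1 - ω + ω ^ 2) * c 1 j + 2 * (ω - 1) * c 2 j) * h
  rw [this]
  exact Submodule.smul_mem _ _ (hc 2)

/-- The columns of A sum to 3, 0, 0, so taking all three components equal to c/3 works. -/
theorem exists_mem_codeC_block (hω : IsPrimitiveRoot ω 3) {c : Fin n → F} (hc : c ∈ grs α 4) :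
    ∃ w ∈ codeC ω α, block w 0 = c ∧ block w 1 = 0 ∧ block w 2 = 0 := by
  have h3 := three_ne_zero_of_primitiveRoot hω
  have h := one_add_add_sq_eq_zero hω
  let w : Fin (3 * n) → F := fun k =>
    if (finProdFinEquiv.symm k).1 = 0 then c (finProdFinEquiv.symm k).2 else 0
  have hw : ∀ (i : Fin 3) j, w (finProdFinEquiv (i, j)) = if i = 0 then c j else 0 := by
    intro i j
    simp only [w, Equiv.symm_apply_apply]
  refine ⟨w, ⟨fun _ => (3 : F)⁻¹ • c, fun m => Submodule.smul_mem _ _ ?_, fun i j => ?_⟩,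
    funext fun j => ?_, funext fun j => ?_, funext fun j => ?_⟩
  · fin_cases m
    · exact grs_anti (by norm_num) hc
    · exact grs_anti (by norm_num) hc
    · exact hc
  · rw [hw, ← Finset.sum_mul, Fin.sum_univ_three]
    fin_cases i
    · simp only [matA, Matrix.of_apply, Matrix.cons_val', Matrix.cons_val_zero,
        Matrix.cons_val_one, Matrix.cons_val, Matrix.cons_val_fin_one, Fin.zero_eta, if_true,
        Pi.smul_apply, smul_eq_mul]
      field_simp
      ring
    · have : (1 : F) + ω + ω ^ 2 = 0 := h
      simp [matA, this]
    · have : (1 : F) + ω ^ 2 + ω = 0 := by rw [← h]; ring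
      simp [matA, this]
  · exact (hw 0 j).trans (if_pos rfl)
  · exact (hw 1 j).trans (if_neg (by decide))
  · exact (hw 2 j).trans (if_neg (by decide))

theorem finrank_codeC (hω : IsPrimitiveRoot ω 3) (hα : Function.Injective α) (hn : 5 ≤ n) :
    Module.finrank F (codeC ω α) = 3 * n - 8 := by
  rw [codeC, finrank_matrixProduct _ (det_matA_ne_zero hω), Fin.sum_univ_three]
  change Module.finrank F (grs α 2) + Module.finrank F (grs α 2) + Module.finrank F (grs α 4) = _
  rw [finrank_grs hα (by omega), finrank_grs hα (by omega)]
  omega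

theorem eq_zero_of_block_eq_zero {w : Fin (3 * n) → F} (h : ∀ i, block w i = 0) : w = 0 := by
  funext k
  obtain ⟨⟨i, j⟩, rfl⟩ := finProdFinEquiv.surjective k
  exact congrFun (h i) j

theorem permuteWord_injective : Function.Injective (permuteWord F n) :=
  LinearMap.funLeft_injective_of_surjective _ _ _ ((phi n).trans (rho n).symm).surjective

theorem finrank_codeD (hω : IsPrimitiveRoot ω 3) (hα : Function.Injective α) (hn : 5 ≤ n) :
    Module.finrank F (codeD ω α) = 3 * n - 8 := by
  rw [← finrank_codeC hω hα hn]
  exact ((codeC ω α).equivMapOfInjective _ permuteWord_injective).symm.finrank_eq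

end MatrixProduct

/-! ### Minimum distance as minimum weight -/

section MinDist

variable {F : Type*} [Field F] [DecidableEq F] {N : ℕ}

theorem isMinHammingDist_of_submodule {C : Submodule F (Fin N → F)} {d : ℕ} (hd : d ≠ 0)
    (hle : ∀ w ∈ C, w ≠ 0 → d ≤ hammingNorm w) (hex : ∃ w ∈ C, hammingNorm w = d) :
    IsMinHammingDist (C : Set (Fin N → F)) d := by
  refine ⟨?_, ?_⟩
  · obtain ⟨w, hw, rfl⟩ := hex
    refine ⟨w, hw, 0, C.zero_mem, ?_, hammingDist_zero_right w⟩
    rwa [← hammingNorm_ne_zero_iff]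
  · rintro e ⟨u, hu, v, hv, huv, rfl⟩
    rw [hammingDist_eq_hammingNorm]
    exact hle _ (C.add_mem (C.neg_mem hu) hv) fun h => huv (neg_add_eq_zero.mp h)

theorem pairDist_eq_hammingNorm (u v : Fin N → F) :
    pairDist u v = hammingNorm (readVector (-u + v)) := by
  rw [pairDist, hammingDist_eq_hammingNorm]
  rfl

theorem isMinPairDist_of_submodule {C : Submodule F (Fin N → F)} {d : ℕ} (hd : d ≠ 0)
    (hle : ∀ w ∈ C, w ≠ 0 → d ≤ hammingNorm (readVector w))
    (hex : ∃ w ∈ C, hammingNorm (readVector w) = d) :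
    IsMinPairDist (C : Set (Fin N → F)) d := by
  refine ⟨?_, ?_⟩
  · obtain ⟨w, hw, rfl⟩ := hex
    refine ⟨0, C.zero_mem, w, hw, ?_, by rw [pairDist_eq_hammingNorm, neg_zero, zero_add]⟩
    rintro rfl
    exact hd (hammingNorm_eq_zero.mpr rfl)
  · rintro e ⟨u, hu, v, hv, huv, rfl⟩
    rw [pairDist_eq_hammingNorm]
    exact hle _ (C.add_mem (C.neg_mem hu) hv) fun h => huv (neg_add_eq_zero.mp h)

end MinDist

/-! ### Weights and pair weights of the two codes -/

section Codes

variable {F : Type*} [Field F] [DecidableEq F] {n : ℕ} {ω : F} {α : Fin n → F}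

theorem hammingNorm_eq_sum_block (w : Fin (3 * n) → F) :
    hammingNorm w = ∑ i, hammingNorm (block w i) := by
  simp only [hammingNorm, Finset.card_filter]
  rw [← Fintype.sum_prod_type', ← Equiv.sum_comp finProdFinEquiv]
  rfl

theorem block_zero_or_three_le (hα : Function.Injective α) {w : Fin (3 * n) → F}
    (hw : w ∈ codeC ω α) (i : Fin 3) : block w i = 0 ∨ 3 ≤ hammingNorm (block w i) := by
  by_cases h : block w i = 0
  · exact Or.inl h
  · exact Or.inr (lt_hammingNorm_of_mem_grs hα (block_mem_grs hw i) h)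

theorem five_le_hammingNorm_block (hω : IsPrimitiveRoot ω 3) (hα : Function.Injective α)
    {w : Fin (3 * n) → F} (hw : w ∈ codeC ω α) {i : Fin 3} (hi : block w i ≠ 0)
    (hother : ∀ k, k ≠ i → block w k = 0) : 5 ≤ hammingNorm (block w i) := by
  refine lt_hammingNorm_of_mem_grs hα ?_ hi
  have h0 : ω ≠ 0 := hω.ne_zero (by norm_num)
  have h := sum_block_mem_grs hω hw
  fin_cases i
  · simpa [hother 1 (by decide), hother 2 (by decide)] using h
  · rw [hother 0 (by decide), hother 2 (by decide), smul_zero, zero_add, add_zero] at h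
    exact (Submodule.smul_mem_iff _ h0).mp h
  · rw [hother 0 (by decide), hother 1 (by decide), smul_zero, zero_add, zero_add] at h
    exact (Submodule.smul_mem_iff _ (pow_ne_zero 2 h0)).mp h

theorem five_le_hammingNorm_codeC (hω : IsPrimitiveRoot ω 3) (hα : Function.Injective α)
    {w : Fin (3 * n) → F} (hw : w ∈ codeC ω α) (h0 : w ≠ 0) : 5 ≤ hammingNorm w := by
  rw [hammingNorm_eq_sum_block]
  obtain ⟨i, hi⟩ : ∃ i, block w i ≠ 0 := by
    by_contra! h
    exact h0 (eq_zero_of_block_eq_zero h)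
  by_cases hother : ∀ k, k ≠ i → block w k = 0
  · exact (five_le_hammingNorm_block hω hα hw hi hother).trans
      (Finset.single_le_sum (f := fun i => hammingNorm (block w i)) (fun _ _ => Nat.zero_le _)
        (Finset.mem_univ i))
  · push Not at hother
    obtain ⟨k, hki, hk⟩ := hother
    have h1 := (block_zero_or_three_le hα hw i).resolve_left hi
    have h2 := (block_zero_or_three_le hα hw k).resolve_left hk
    have h3 := Finset.sum_le_sum_of_subset (f := fun i => hammingNorm (block w i))
      (Finset.subset_univ {k, i})
    rw [Finset.sum_pair hki] at h3
    omega

theorem exists_mem_codeC_hammingNorm (hω : IsPrimitiveRoot ω 3) (hα : Function.Injective α)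
    (hn : 5 ≤ n) : ∃ w ∈ codeC ω α,
      hammingNorm (block w 0) = 5 ∧ block w 1 = 0 ∧ block w 2 = 0 := by
  obtain ⟨c, hc, hc5⟩ := exists_mem_grs_hammingNorm hα (i := 4) (by omega)
  obtain ⟨w, hw, h0, h1, h2⟩ := exists_mem_codeC_block hω hc
  exact ⟨w, hw, by rw [h0, hc5], h1, h2⟩

theorem isLinearCode_codeC (hω : IsPrimitiveRoot ω 3) (hα : Function.Injective α) (hn : 5 ≤ n) :
    IsLinearCode (codeC ω α) (3 * n - 8) 5 := by
  refine ⟨finrank_codeC hω hα hn, isMinHammingDist_of_submodule (by norm_num)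
    (fun w hw h0 => five_le_hammingNorm_codeC hω hα hw h0) ?_⟩
  obtain ⟨w, hw, h0, h1, h2⟩ := exists_mem_codeC_hammingNorm hω hα hn
  exact ⟨w, hw, by rw [hammingNorm_eq_sum_block, Fin.sum_univ_three, h0, h1, h2]; simp⟩

theorem hammingNorm_permuteWord (w : Fin (3 * n) → F) :
    hammingNorm (permuteWord F n w) = hammingNorm w := by
  simp only [hammingNorm, Finset.card_filter]
  exact Equiv.sum_comp ((phi n).trans (rho n).symm) fun k => if w k ≠ 0 then 1 else 0

theorem isLinearCode_codeD (hω : IsPrimitiveRoot ω 3) (hα : Function.Injective α) (hn : 5 ≤ n) :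
    IsLinearCode (codeD ω α) (3 * n - 8) 5 := by
  refine ⟨finrank_codeD hω hα hn, isMinHammingDist_of_submodule (by norm_num) ?_ ?_⟩
  · rintro _ ⟨w, hw, rfl⟩ h0
    rw [hammingNorm_permuteWord]
    exact five_le_hammingNorm_codeC hω hα hw fun h => h0 (by rw [h, map_zero])
  · obtain ⟨w, hw, h0, h1, h2⟩ := exists_mem_codeC_hammingNorm hω hα hn
    refine ⟨_, ⟨w, hw, rfl⟩, ?_⟩
    rw [hammingNorm_permuteWord, hammingNorm_eq_sum_block, Fin.sum_univ_three, h0, h1, h2]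
    simp

theorem val_finRotate {N : ℕ} (i : Fin N) :
    (finRotate N i : ℕ) = if (i : ℕ) + 1 = N then 0 else (i : ℕ) + 1 := by
  obtain _ | N := N
  · exact i.elim0
  · rw [coe_finRotate]
    simp [Fin.ext_iff]

theorem mem_map_finRotate {J : Finset (Fin n)} {j : Fin n} :
    finRotate n j ∈ J.map (finRotate n).toEmbedding ↔ j ∈ J :=
  Finset.mem_map' (finRotate n).toEmbedding

theorem mem_map_finRotate_symm {J : Finset (Fin n)} {j : Fin n} :
    j ∈ J.map (finRotate n).symm.toEmbedding ↔ finRotate n j ∈ J := by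
  rw [Finset.mem_map_equiv, Equiv.symm_symm]

theorem val_interleaved (j : Fin n) (i : Fin 3) :
    (interleaved n (j, i) : ℕ) = i + 3 * j := by
  simp [interleaved, finProdFinEquiv_apply_val]

theorem finRotate_interleaved (j : Fin n) :
    finRotate (3 * n) (interleaved n (j, 0)) = interleaved n (j, 1) ∧
    finRotate (3 * n) (interleaved n (j, 1)) = interleaved n (j, 2) ∧
    finRotate (3 * n) (interleaved n (j, 2)) = interleaved n (finRotate n j, 0) := by
  have hj := j.2
  refine ⟨Fin.ext ?_, Fin.ext ?_, Fin.ext ?_⟩ <;>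
    simp only [val_finRotate, val_interleaved, Fin.val_zero, Fin.val_one, Fin.val_two] <;>
    split_ifs <;> omega

theorem hammingNorm_readVector (d : Fin (3 * n) → F) :
    hammingNorm (readVector d) =
      (Finset.univ.filter fun j => d (interleaved n (j, 0)) ≠ 0 ∨
        d (interleaved n (j, 1)) ≠ 0).card +
      (Finset.univ.filter fun j => d (interleaved n (j, 1)) ≠ 0 ∨
        d (interleaved n (j, 2)) ≠ 0).card +
      (Finset.univ.filter fun j => d (interleaved n (j, 2)) ≠ 0 ∨
        d (interleaved n (finRotate n j, 0)) ≠ 0).card := by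
  simp only [hammingNorm, Finset.card_filter]
  rw [← Equiv.sum_comp (interleaved n), Fintype.sum_prod_type]
  simp only [Fin.sum_univ_three, Finset.sum_add_distrib, readVector, (finRotate_interleaved _).1,
    (finRotate_interleaved _).2.1, (finRotate_interleaved _).2.2, ne_eq, Prod.mk_eq_zero,
    not_and_or]

/-- The positions `j` for which the symbol with number `3 * j + i` of `permuteWord F n w` is
nonzero. -/
def rowSupport (w : Fin (3 * n) → F) (i : Fin 3) : Finset (Fin n) :=
  Finset.univ.filter fun j => permuteWord F n w (interleaved n (j, i)) ≠ 0

theorem mem_rowSupport {w : Fin (3 * n) → F} {i : Fin 3} {j : Fin n} :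
    j ∈ rowSupport w i ↔ block w i (if i = 1 then finRotate n j else j) ≠ 0 := by
  rw [rowSupport, Finset.mem_filter, permuteWord_apply]
  simp [block]

theorem card_rowSupport (w : Fin (3 * n) → F) (i : Fin 3) :
    (rowSupport w i).card = hammingNorm (block w i) := by
  have h : rowSupport w i = Finset.univ.filter fun j =>
      block w i ((if i = 1 then finRotate n else Equiv.refl _) j) ≠ 0 := by
    ext j
    rw [mem_rowSupport]
    by_cases hi : i = 1 <;> simp [hi]
  rw [h]
  simp only [hammingNorm, Finset.card_filter]
  exact Equiv.sum_comp _ fun k => if block w i k ≠ 0 then 1 else 0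

theorem hammingNorm_readVector_permuteWord (w : Fin (3 * n) → F) :
    hammingNorm (readVector (permuteWord F n w)) =
      (rowSupport w 0 ∪ rowSupport w 1).card + (rowSupport w 1 ∪ rowSupport w 2).card +
      (rowSupport w 2 ∪ (rowSupport w 0).map (finRotate n).symm.toEmbedding).card := by
  rw [hammingNorm_readVector]
  congr 2
  · congr 1
    ext j
    simp [rowSupport]
  · congr 1
    ext j
    simp [rowSupport]
  · ext j
    simp only [rowSupport, Finset.mem_union, mem_map_finRotate_symm, Finset.mem_filter,
      Finset.mem_univ, true_and]

theorem ten_le_card_add_card_add_card_union {ι : Type*} [DecidableEq ι] {A B : Finset ι}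
    (hA : 3 ≤ A.card) (hB : 3 ≤ B.card) :
    10 ≤ A.card + B.card + (A ∪ B).card ∨ (A = B ∧ A.card = 3) := by
  by_contra! h
  have h1 := Finset.card_le_card (Finset.subset_union_left (s₁ := A) (s₂ := B))
  have h2 := Finset.card_le_card (Finset.subset_union_right (s₁ := A) (s₂ := B))
  have h3 := Finset.eq_of_subset_of_card_le (Finset.subset_union_left (s₁ := A) (s₂ := B))
    (by omega)
  have h4 := Finset.eq_of_subset_of_card_le (Finset.subset_union_right (s₁ := A) (s₂ := B))
    (by omega)
  exact h.2 (h3.trans h4.symm) (by omega)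

/-- The cyclic shift is transitive, so an invariant set containing one index contains all. -/
theorem eq_univ_of_map_finRotate_symm {J : Finset (Fin n)} (hJ : J.Nonempty)
    (h : J.map (finRotate n).symm.toEmbedding = J) : J = Finset.univ := by
  have hstep : ∀ j, finRotate n j ∈ J ↔ j ∈ J := by
    intro j
    conv_rhs => rw [← h]
    rw [mem_map_finRotate_symm]
  obtain _ | n := n
  · exact Subsingleton.elim _ _
  have hall : ∀ (j : Fin (n + 1)), j ∈ J ↔ (0 : Fin (n + 1)) ∈ J := by
    intro j
    induction j using Fin.induction with
    | zero => rfl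
    | succ j ih =>
      rw [← ih, ← hstep j.castSucc]
      congr! 1
      have hj := j.2
      exact Fin.ext (by rw [val_finRotate, Fin.val_castSucc, if_neg (by omega), Fin.val_succ])
  obtain ⟨x, hx⟩ := hJ
  exact Finset.eq_univ_of_forall fun j => (hall j).mpr ((hall x).mp hx)

theorem ten_le_pairWeight (hω : IsPrimitiveRoot ω 3) (hα : Function.Injective α) (hn : 5 ≤ n)
    (hJ : ∀ J : Finset (Fin n), J.card = 3 → ∑ j ∈ J, α (finRotate n j) ≠ ∑ j ∈ J, α j)
    {w : Fin (3 * n) → F} (hw : w ∈ codeC ω α) (h0 : w ≠ 0) :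
    10 ≤ hammingNorm (readVector (permuteWord F n w)) := by
  have hω0 : ω ≠ 0 := hω.ne_zero (by norm_num)
  have hsum := sum_block_mem_grs hω hw
  have hempty : ∀ {i}, block w i = 0 → rowSupport w i = ∅ := by
    intro i hi
    rw [← Finset.card_eq_zero, card_rowSupport, hi, hammingNorm_zero]
  have hcard : ∀ {i}, block w i ≠ 0 → 3 ≤ (rowSupport w i).card := by
    intro i hi
    rw [card_rowSupport]
    exact (block_zero_or_three_le hα hw i).resolve_left hi
  have hfive : ∀ {i}, block w i ≠ 0 → (∀ k, k ≠ i → block w k = 0) →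
      5 ≤ (rowSupport w i).card := by
    intro i hi hk
    rw [card_rowSupport]
    exact five_le_hammingNorm_block hω hα hw hi hk
  have hmem0 : ∀ j, block w 0 j ≠ 0 ↔ j ∈ rowSupport w 0 := fun j => by
    rw [mem_rowSupport, if_neg (by decide)]
  have hmem1 : ∀ j, block w 1 j ≠ 0 ↔ j ∈ (rowSupport w 1).map (finRotate n).toEmbedding := by
    intro j
    obtain ⟨j, rfl⟩ := (finRotate n).surjective j
    rw [mem_map_finRotate, mem_rowSupport, if_pos rfl]
  have hmem2 : ∀ j, block w 2 j ≠ 0 ↔ j ∈ rowSupport w 2 := fun j => by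
    rw [mem_rowSupport, if_neg (by decide)]
  have hmap : ∀ J : Finset (Fin n), ∑ j ∈ J.map (finRotate n).toEmbedding, α j =
      ∑ j ∈ J, α (finRotate n j) := fun J => Finset.sum_map _ _ _
  rw [hammingNorm_readVector_permuteWord]
  by_cases b0 : block w 0 = 0 <;> by_cases b1 : block w 1 = 0 <;> by_cases b2 : block w 2 = 0
  · refine absurd (eq_zero_of_block_eq_zero fun i => ?_) h0
    fin_cases i <;> assumption
  · have := hfive b2 fun k hk => by fin_cases k <;> first | assumption | exact absurd rfl hk
    simp only [hempty b0, hempty b1, Finset.map_empty, Finset.empty_union, Finset.union_empty,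
      Finset.card_empty]
    omega
  · have := hfive b1 fun k hk => by fin_cases k <;> first | assumption | exact absurd rfl hk
    simp only [hempty b0, hempty b2, Finset.map_empty, Finset.empty_union, Finset.union_empty,
      Finset.card_empty]
    omega
  · simp only [hempty b0, Finset.map_empty, Finset.empty_union, Finset.union_empty]
    rcases ten_le_card_add_card_add_card_union (hcard b1) (hcard b2) with h | ⟨heq, h3⟩
    · omega
    · rw [b0, zero_add] at hsum
      refine absurd ?_ (hJ _ h3)
      rw [← hmap]
      refine sum_support_eq_of_smul_add_smul_mem_grs_four hα (block_mem_grs hw 1)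
        (block_mem_grs hw 2) hω0 hsum (by rwa [Finset.card_map]) h3 hmem1 fun j => ?_
      rw [hmem2, heq]
  · have := hfive b0 fun k hk => by fin_cases k <;> first | assumption | exact absurd rfl hk
    simp only [hempty b1, hempty b2, Finset.empty_union, Finset.union_empty,
      Finset.card_empty, Finset.card_map]
    omega
  · simp only [hempty b1, Finset.empty_union, Finset.union_empty]
    have hmapcard := Finset.card_map (s := rowSupport w 0) (finRotate n).symm.toEmbedding
    rcases ten_le_card_add_card_add_card_union (hcard b2) (hmapcard.ge.trans' (hcard b0)) with
      h | ⟨heq, h3⟩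
    · omega
    · rw [b1, smul_zero, add_zero, ← one_smul F (block w 0)] at hsum
      refine absurd ?_ (hJ _ h3)
      rw [← hmap]
      refine sum_support_eq_of_smul_add_smul_mem_grs_four hα (block_mem_grs hw 0)
        (block_mem_grs hw 2) one_ne_zero hsum (by rwa [Finset.card_map]) h3 (fun j => ?_) hmem2
      obtain ⟨j, rfl⟩ := (finRotate n).surjective j
      rw [hmem0, heq, mem_map_finRotate, mem_map_finRotate_symm]
  · simp only [hempty b2, Finset.empty_union, Finset.union_empty, Finset.card_map]
    rcases ten_le_card_add_card_add_card_union (hcard b0) (hcard b1) with h | ⟨heq, h3⟩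
    · omega
    · rw [b2, smul_zero, add_zero, ← one_smul F (block w 0)] at hsum
      refine absurd ?_ (hJ _ h3)
      rw [← hmap]
      refine (sum_support_eq_of_smul_add_smul_mem_grs_four hα (block_mem_grs hw 0)
        (block_mem_grs hw 1) one_ne_zero hsum h3 (by rwa [Finset.card_map]) hmem0
        fun j => ?_).symm
      rw [hmem1, heq]
  -- Each of the three unions has at least 3 elements; a total below 10 forces all to have exactly
  -- 3, so all row supports agree with a shift of themselves.
  · by_contra! hlt
    have c0 := hcard b0
    have c1 := hcard b1
    have c2 := hcard b2
    set A := rowSupport w 0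
    set B := rowSupport w 1
    set C := rowSupport w 2
    have hmapcard := Finset.card_map (s := A) (finRotate n).symm.toEmbedding
    set A' := A.map (finRotate n).symm.toEmbedding
    have eq_union : ∀ {X Y : Finset (Fin n)}, 3 ≤ X.card → 3 ≤ Y.card → (X ∪ Y).card ≤ 3 →
        X = Y := by
      intro X Y hX hY hXY
      exact (Finset.eq_of_subset_of_card_le Finset.subset_union_left (by omega)).trans
        (Finset.eq_of_subset_of_card_le Finset.subset_union_right (by omega)).symm
    have l1 := Finset.card_le_card (Finset.subset_union_left (s₁ := A) (s₂ := B))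
    have l2 := Finset.card_le_card (Finset.subset_union_left (s₁ := B) (s₂ := C))
    have l3 := Finset.card_le_card (Finset.subset_union_left (s₁ := C) (s₂ := A'))
    have hAB := eq_union c0 c1 (by omega)
    have hBC := eq_union c1 c2 (by omega)
    have hCA := eq_union c2 (Y := A') (by omega) (by omega)
    have hAA : A' = A := (hAB.trans (hBC.trans hCA)).symm
    have huniv := eq_univ_of_map_finRotate_symm (Finset.card_pos.mp (by omega)) hAA
    have hcn : A.card = n := by rw [huniv]; simp
    omega

theorem isMDSPairCode_codeD [Fintype F] (hω : IsPrimitiveRoot ω 3) (hα : Function.Injective α)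
    (hn : 5 ≤ n)
    (hJ : ∀ J : Finset (Fin n), J.card = 3 → ∑ j ∈ J, α (finRotate n j) ≠ ∑ j ∈ J, α j) :
    IsMDSPairCode (codeD ω α : Set (Fin (3 * n) → F)) 10 := by
  refine ⟨by norm_num, by omega, isMinPairDist_of_submodule (by norm_num) ?_ ?_, ?_⟩
  · rintro _ ⟨w, hw, rfl⟩ h0
    exact ten_le_pairWeight hω hα hn hJ hw fun h => h0 (by rw [h, map_zero])
  -- A word with five nonzero symbols, all in row 0: no two are adjacent, so each lies in two pairs
  -- of its own.
  · obtain ⟨w, hw, h0, h1, h2⟩ := exists_mem_codeC_hammingNorm hω hα hn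
    refine ⟨_, ⟨w, hw, rfl⟩, ?_⟩
    have e0 := card_rowSupport w 0
    have e1 : rowSupport w 1 = ∅ := by
      rw [← Finset.card_eq_zero, card_rowSupport, h1, hammingNorm_zero]
    have e2 : rowSupport w 2 = ∅ := by
      rw [← Finset.card_eq_zero, card_rowSupport, h2, hammingNorm_zero]
    rw [hammingNorm_readVector_permuteWord, e1, e2]
    simp only [Finset.empty_union, Finset.union_empty, Finset.card_empty, Finset.card_map]
    omega
  · have hk : 3 * n - 10 + 2 = 3 * n - 8 := by omega
    rw [hk, ← finrank_codeD hω hα hn]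
    exact Module.natCard_eq_pow_finrank (K := F) (V := codeD ω α)

end Codes

theorem exists_primitiveRoot_three {F : Type*} [Field F] [Fintype F]
    (hq : Fintype.card F ≡ 1 [MOD 3]) : ∃ ω : F, IsPrimitiveRoot ω 3 := by
  obtain ⟨g, hg⟩ := IsCyclic.exists_ofOrder_eq_natCard (α := Fˣ)
  have hprim := IsPrimitiveRoot.orderOf g
  have hcard : Nat.card Fˣ = Fintype.card F - 1 := by
    rw [Nat.card_units, Nat.card_eq_fintype_card]
  have hlt := Fintype.one_lt_card (α := F)
  rw [hg, hcard] at hprim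
  obtain ⟨k, hk⟩ : 3 ∣ Fintype.card F - 1 := (Nat.modEq_iff_dvd' (by omega)).mp hq.symm
  exact ⟨_, IsPrimitiveRoot.coe_units_iff.mpr
    (hprim.pow (by omega) (by rw [hk, mul_comm] : Fintype.card F - 1 = k * 3))⟩

end SymbolPair

theorem theorem3p3 {F : Type*} [Field F] [Fintype F] [DecidableEq F] (q n : ℕ)
    (hF : Fintype.card F = q) (hq : q ≡ 1 [MOD 3]) (hn5 : 5 ≤ n) (hnq : n ≤ q) :
    (∃ ω : F, IsPrimitiveRoot ω 3) ∧
    ∀ ω : F, IsPrimitiveRoot ω 3 →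
      ∃ α : Fin n → F, Function.Injective α ∧
        SymbolPair.IsLinearCode (SymbolPair.codeC ω α) (3 * n - 8) 5 ∧
        SymbolPair.IsLinearCode (SymbolPair.codeD ω α) (3 * n - 8) 5 ∧
        SymbolPair.IsMDSPairCode (SymbolPair.codeD ω α : Set (Fin (3 * n) → F)) 10 := by
  subst hF
  refine ⟨SymbolPair.exists_primitiveRoot_three hq, fun ω hω => ?_⟩
  obtain ⟨α, hα, hJ⟩ := SymbolPair.hasTripleFreeCycle_field hq hn5 hnq
  exact ⟨α, hα, SymbolPair.isLinearCode_codeC hω hα hn5, SymbolPair.isLinearCode_codeD hω hα hn5,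
    SymbolPair.isMDSPairCode_codeD hω hα hn5 hJ⟩
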